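/- Let $X$ be a real Banach space with closed unit ball $B_X$, unit sphere $S_X$ and group of rotations $\mathcal G_X$ (the linear isometries of $X$ onto $X$). Suppose that: 1. $X$ is convex-transitive: $\overline{\mathrm{conv}}\{T(x) : T\in\mathcal G_X\}=B_X$ for every $x\in S_X$; 2. $X$ admits a $1$-dimensional bicontractive projection: there are a $1$-dimensional linear subspace $L\subset X$ and a bounded linear projection $P\colon X\to L$ onto $L$ such that $\|P\|=\|I-P\|=1$; 3. $S_X$ contains at least one $\omega$-LUR point, that is, a point $x\in S_X$ such that every sequence $(x_n)\subset B_X$ with $\|x+x_n\|\to 2$ converges weakly to $x$. Then $X$ is isometrically a Hilbert space, that is, there is a linear isometry of $X$ onto a real Hilbert space. -/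

import Mathlib

open Filter Topology

namespace RotationProblem

variable {X : Type*} [NormedAddCommGroup X] [NormedSpace ℝ X]

/-- A point `x` of the unit sphere is a *big point* if the closed convex hull of its orbit under
the group of rotations (surjective linear isometries `X ≃ₗᵢ[ℝ] X`) is the closed unit ball. -/
def IsBigPoint (x : X) : Prop :=
  ‖x‖ = 1 ∧
    closure (convexHull ℝ (Set.range fun T : X ≃ₗᵢ[ℝ] X => T x)) = Metric.closedBall (0 : X) 1

variable (X) in
/-- `X` is *convex-transitive* if each point of its unit sphere is a big point. -/
def IsConvexTransitive : Prop :=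
  ∀ x : X, ‖x‖ = 1 → IsBigPoint x

/-- `P` is a *bicontractive projection* onto the subspace `L`: a bounded linear projection with
range `L` such that `‖P‖ = ‖I - P‖ = 1`. -/
def IsBicontractiveProjection (P : X →L[ℝ] X) (L : Submodule ℝ X) : Prop :=
  LinearMap.IsProj L P.toLinearMap ∧ ‖P‖ = 1 ∧ ‖ContinuousLinearMap.id ℝ X - P‖ = 1

/-- A point `x` of the unit sphere is an *`ω`-LUR* (weakly locally uniformly rotund) point if every
sequence `(xₙ)` in the closed unit ball with `‖x + xₙ‖ → 2` converges weakly to `x`. -/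
def IsWeakLURPoint (x : X) : Prop :=
  ‖x‖ = 1 ∧
    ∀ u : ℕ → X, (∀ n, ‖u n‖ ≤ 1) → Tendsto (fun n => ‖x + u n‖) atTop (𝓝 2) →
      Tendsto (fun n => toWeakSpace ℝ X (u n)) atTop (𝓝 (toWeakSpace ℝ X x))

/-- `X` is *isometrically a Hilbert space*: there is a surjective linear isometry from `X` onto
a real Hilbert space. -/
def IsIsometricallyHilbert.{u} (X : Type u) [NormedAddCommGroup X] [NormedSpace ℝ X] : Prop :=
  ∃ (H : Type u) (_ : NormedAddCommGroup H) (_ : InnerProductSpace ℝ H) (_ : CompleteSpace H),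
    Nonempty (X ≃ₗᵢ[ℝ] H)

end RotationProblem

/-! A one-dimensional bicontractive projection has the form `z ↦ φ z • e`. Rotating it towards the
ω-LUR point and passing to a limit yields such a pair `(x, f)` at that point
(`exists_bicontractivePair_of_isWeakLURPoint`). For rotations `T` with `f (T x)` near 1, either `T
x` must be norm close to `x`, or `f ∘ T` must be norm close to `f` (`orbit_dichotomy`). Convex
transitivity spreads this from the orbit: `f` strongly exposes `x` in the first case, and `x`
strongly exposes `f` in the second. Hence either `X` or its dual is strictly convex, with a dense
orbit on the sphere and a bicontractive pair. Such a space satisfies the parallelogram law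
(`parallelogram_of_dense_orbit`). In finite dimension this comes from an invariant quadratic form.
In infinite dimension every unit vector carries a pair, the resulting orthogonality is symmetric,
and a third orthogonal direction forces each plane to be Euclidean. Finally, the law passes from the
dual back to `X`. -/

namespace RotationProblem

/-! ### Functional equation of a symmetric incidence relation. -/

section FunctionalEquation

variable {F G : ℝ → ℝ}

theorem graph_relation (hG : ∀ r, G r = 0 → r = 0)
    (H : ∀ t r t' r', 1 + F t * t' + G r * r' = 0 → 1 + F t' * t + G r' * r = 0) (t t' : ℝ) :
    G (-(1 + F t * t') / G 1) = -(1 + F t' * t) := by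
  have hg : G 1 ≠ 0 := fun h => one_ne_zero (hG 1 h)
  have := H t 1 t' (-(1 + F t * t') / G 1) (by field_simp; ring)
  linarith

theorem normalized_involution (hF : ∀ t, F t = 0 → t = 0) (hG : ∀ r, G r = 0 → r = 0)
    (H : ∀ t r t' r', 1 + F t * t' + G r * r' = 0 → 1 + F t' * t + G r' * r = 0) (t t' : ℝ) :
    F (F t / F 1 * t') / F 1 = F t' / F 1 * t := by
  have hc : F 1 ≠ 0 := fun h => one_ne_zero (hF 1 h)
  have h1 := graph_relation hG H t t'
  have h2 := graph_relation hG H 1 (F t / F 1 * t')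
  have h3 : F 1 * (F t / F 1 * t') = F t * t' := by field_simp
  rw [h3, h1] at h2
  have h4 : F (F t / F 1 * t') = F t' * t := by linarith
  rw [h4]; ring

/-- With `f = F / F 1`, the previous identity reads `f (f t * t') = f t' * t`. Taking `t' = 1` makes
`f` an involution; replacing `t` by `f a` then gives multiplicativity. -/
theorem normalized_mul (hF : ∀ t, F t = 0 → t = 0) (hG : ∀ r, G r = 0 → r = 0)
    (H : ∀ t r t' r', 1 + F t * t' + G r * r' = 0 → 1 + F t' * t + G r' * r = 0) :
    (∀ a, F (F a / F 1) / F 1 = a) ∧ ∀ a b, F (a * b) / F 1 = F a / F 1 * (F b / F 1) := by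
  have hc : F 1 ≠ 0 := fun h => one_ne_zero (hF 1 h)
  have key := normalized_involution hF hG H
  have inv : ∀ a, F (F a / F 1) / F 1 = a := fun a => by
    have := key a 1
    rwa [mul_one, div_self hc, one_mul] at this
  refine ⟨inv, fun a b => ?_⟩
  have := key (F a / F 1) b
  rw [inv] at this
  rw [this]; ring

theorem normalized_shift (hF0 : F 0 = 0) (hG0 : G 0 = 0)
    (hF : ∀ t, F t = 0 → t = 0) (hG : ∀ r, G r = 0 → r = 0)
    (H : ∀ t r t' r', 1 + F t * t' + G r * r' = 0 → 1 + F t' * t + G r' * r = 0) (s : ℝ) :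
    G (1 + s) / G 1 = 1 + F s / F 1 := by
  have hc : F 1 ≠ 0 := fun h => one_ne_zero (hF 1 h)
  have hg : G 1 ≠ 0 := fun h => one_ne_zero (hG 1 h)
  have H' : ∀ t r t' r', 1 + G t * t' + F r * r' = 0 → 1 + G t' * t + F r' * r = 0 :=
    fun t r t' r' h => by
      have := H r t r' t' (by linarith)
      linarith
  obtain ⟨iF, mF⟩ := normalized_mul hF hG H
  obtain ⟨iG, mG⟩ := normalized_mul hG hF H'
  have hm1 : F (-1) / F 1 = -1 := by
    have h := mF (-1) (-1)
    rw [neg_mul_neg, one_mul, div_self hc] at h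
    rcases mul_self_eq_one_iff.1 h.symm with h | h
    · have := iF (-1)
      rw [h, div_self hc] at this
      norm_num at this
    · exact h
  have base : ∀ s, G (-(1 + s) / G 1) = -(1 + F 1 * (F (1 / F 1) / F 1) * (F s / F 1)) := fun s => by
    have h := graph_relation hG H 1 (s / F 1)
    have h1 : F 1 * (s / F 1) = s := by field_simp
    rw [h1] at h
    have h2 := mF (1 / F 1) s
    have h3 : 1 / F 1 * s = s / F 1 := by ring
    rw [h3] at h2
    have h4 : F (s / F 1) = F 1 * (F (1 / F 1) / F 1) * (F s / F 1) := by
      rw [mul_assoc, ← h2]; field_simp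
    rw [h, h4, mul_one]
  have b0 : G (-1 / G 1) = -1 := by
    have := base 0
    simpa [hF0] using this
  have mul' : ∀ s, G (-(1 + s) / G 1) = -(G (1 + s) / G 1) := fun s => by
    have h := mG (-1 / G 1) (1 + s)
    have h1 : -1 / G 1 * (1 + s) = -(1 + s) / G 1 := by ring
    rw [h1, b0, div_mul_eq_mul_div, div_left_inj' hg] at h
    rw [h]; ring
  -- At `s = -1` the left side of `base` is `G 0 = 0`, which fixes the unknown constant.
  have k1 : F 1 * (F (1 / F 1) / F 1) = 1 := by
    have h := base (-1)
    rw [hm1] at h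
    have : -(1 + (-1 : ℝ)) / G 1 = 0 := by simp
    rw [this, hG0] at h
    linarith
  have := base s
  rw [k1, mul', one_mul] at this
  linarith

theorem linear_of_symm_relation (hF0 : F 0 = 0) (hG0 : G 0 = 0)
    (hF : ∀ t, F t = 0 → t = 0) (hG : ∀ r, G r = 0 → r = 0)
    (H : ∀ t r t' r', 1 + F t * t' + G r * r' = 0 → 1 + F t' * t + G r' * r = 0) (t : ℝ) :
    F t = F 1 * t := by
  have hc : F 1 ≠ 0 := fun h => one_ne_zero (hF 1 h)
  have hg : G 1 ≠ 0 := fun h => one_ne_zero (hG 1 h)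
  have H' : ∀ t r t' r', 1 + G t * t' + F r * r' = 0 → 1 + G t' * t + F r' * r = 0 :=
    fun t r t' r' h => by
      have := H r t r' t' (by linarith)
      linarith
  obtain ⟨-, mF⟩ := normalized_mul hF hG H
  obtain ⟨-, mG⟩ := normalized_mul hG hF H'
  have sF := normalized_shift hG0 hF0 hG hF H'
  have sG := normalized_shift hF0 hG0 hF hG H
  have two : G 2 / G 1 = 2 := by
    have := sG 1
    rw [div_self hc] at this
    norm_num at this
    linarith
  -- For the normalized `f`, `g`, compute `g (2 * (1 + s))` in two ways: multiplicativity gives `2 +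
  -- 2 * f s`, while two shifts give `2 + g (2 * s) = 2 + 2 * g s`.
  have eq : ∀ s, F s / F 1 = G s / G 1 := fun s => by
    have h1 := mG 2 (1 + s)
    have h2 := sG (1 + 2 * s)
    have h3 := sF (2 * s)
    have h4 := mG 2 s
    have h5 := sG s
    have h6 : 1 + (1 + 2 * s) = 2 * (1 + s) := by ring
    rw [h6] at h2
    rw [two] at h1 h4
    linarith
  have addF : ∀ a b, F (a + b) / F 1 = F a / F 1 + F b / F 1 := fun a b => by
    rcases eq_or_ne a 0 with rfl | ha
    · simp [hF0]
    · have h1 : a + b = a * (1 + b / a) := by field_simp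
      have h2 : F a / F 1 * (F (b / a) / F 1) = F b / F 1 := by
        rw [← mF]; congr 2; field_simp
      rw [h1, mF, sF, ← eq, mul_add, h2, mul_one]
  -- Additivity and multiplicativity suffice without continuity: the only ring endomorphism of `ℝ`
  -- is the identity.
  let φ : ℝ →+* ℝ :=
    { toFun := fun a => F a / F 1
      map_one' := div_self hc
      map_mul' := mF
      map_zero' := by simp [hF0]
      map_add' := addF }
  have h : φ = RingHom.id ℝ := Subsingleton.elim _ _
  have h2 : F t / F 1 = t := congrArg (fun ψ : ℝ →+* ℝ => ψ t) h
  field_simp at h2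
  linarith

end FunctionalEquation

/-! ### Symmetric orthogonality and diagonal forms. -/

section Polarity

variable {V : Type*} [AddCommGroup V] [Module ℝ V]

/-- A symmetric orthogonality relation given by a family of linear functionals comes, on the plane
spanned by two members of an orthogonal triple, from a positive definite diagonal form. -/
theorem exists_diagonal_form {J : V → V →ₗ[ℝ] ℝ} (hJ : ∀ y, y ≠ 0 → J y y ≠ 0)
    (hs : ∀ y z, y ≠ 0 → z ≠ 0 → J y z = 0 → J z y = 0) {e₁ e₂ e₃ : V}
    (h₁ : e₁ ≠ 0) (h₂ : e₂ ≠ 0) (h₃ : e₃ ≠ 0)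
    (h₁₂ : J e₁ e₂ = 0) (h₁₃ : J e₁ e₃ = 0) (h₂₃ : J e₂ e₃ = 0) :
    ∃ c : ℝ, 0 < c ∧ ∀ t a b : ℝ, a + c * t * b = 0 → J (e₁ + t • e₂) (a • e₁ + b • e₂) = 0 := by
  have h₂₁ := hs _ _ h₁ h₂ h₁₂
  have h₃₁ := hs _ _ h₁ h₃ h₁₃
  have h₃₂ := hs _ _ h₂ h₃ h₂₃
  have ne0 : ∀ t r : ℝ, e₁ + t • e₂ + r • e₃ ≠ 0 := fun t r h => by
    have : J e₁ (e₁ + t • e₂ + r • e₃) = 0 := by rw [h, map_zero]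
    simp [h₁₂, h₁₃] at this
    exact hJ _ h₁ this
  have first : ∀ t r : ℝ, J (e₁ + t • e₂ + r • e₃) e₁ ≠ 0 := fun t r h => by
    have := hs _ _ (ne0 t r) h₁ h
    simp [h₁₂, h₁₃] at this
    exact hJ _ h₁ this
  set F : ℝ → ℝ := fun t => J (e₁ + t • e₂) e₂ / J (e₁ + t • e₂) e₁ with hFdef
  set G : ℝ → ℝ := fun r => J (e₁ + r • e₃) e₃ / J (e₁ + r • e₃) e₁ with hGdef
  have f2 : ∀ t : ℝ, J (e₁ + t • e₂) e₁ ≠ 0 := fun t => by simpa using first t 0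
  have f3 : ∀ r : ℝ, J (e₁ + r • e₃) e₁ ≠ 0 := fun r => by simpa using first 0 r
  have n2 : ∀ t : ℝ, e₁ + t • e₂ ≠ 0 := fun t => by simpa using ne0 t 0
  have n3 : ∀ r : ℝ, e₁ + r • e₃ ≠ 0 := fun r => by simpa using ne0 0 r
  -- The slope along `e₂` ignores `r`: by symmetry `F t • e₁ - e₂` is orthogonal to both `e₁ + t •
  -- e₂` and `e₃`, hence to their combinations.
  have coordF : ∀ t r : ℝ, J (e₁ + t • e₂ + r • e₃) e₂ = J (e₁ + t • e₂ + r • e₃) e₁ * F t := by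
    intro t r
    have hq : F t • e₁ - e₂ ≠ 0 := fun h => by
      have : J e₂ (F t • e₁ - e₂) = 0 := by rw [h, map_zero]
      simp [h₂₁] at this
      exact hJ _ h₂ this
    have q1 : J (F t • e₁ - e₂) (e₁ + t • e₂) = 0 := by
      refine hs _ _ (n2 t) hq ?_
      rw [map_sub, map_smul, smul_eq_mul, hFdef]
      field_simp [f2 t]
      simp
    have q3 : J (F t • e₁ - e₂) e₃ = 0 := by
      refine hs _ _ h₃ hq ?_
      simp [h₃₁, h₃₂]
    have := hs _ _ hq (ne0 t r) (by rw [map_add, q1, map_smul, q3, smul_zero, add_zero])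
    rw [map_sub, map_smul, smul_eq_mul] at this
    linarith
  have coordG : ∀ t r : ℝ, J (e₁ + t • e₂ + r • e₃) e₃ = J (e₁ + t • e₂ + r • e₃) e₁ * G r := by
    intro t r
    have hq : G r • e₁ - e₃ ≠ 0 := fun h => by
      have : J e₃ (G r • e₁ - e₃) = 0 := by rw [h, map_zero]
      simp [h₃₁] at this
      exact hJ _ h₃ this
    have q1 : J (G r • e₁ - e₃) (e₁ + r • e₃) = 0 := by
      refine hs _ _ (n3 r) hq ?_
      rw [map_sub, map_smul, smul_eq_mul, hGdef]
      field_simp [f3 r]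
      simp
    have q3 : J (G r • e₁ - e₃) e₂ = 0 := by
      refine hs _ _ h₂ hq ?_
      simp [h₂₁, h₂₃]
    have := hs _ _ hq (ne0 t r) (by
      rw [add_right_comm, map_add, q1, map_smul, q3, smul_zero, add_zero])
    rw [map_sub, map_smul, smul_eq_mul] at this
    linarith
  have expand : ∀ t r t' r' : ℝ, J (e₁ + t • e₂ + r • e₃) (e₁ + t' • e₂ + r' • e₃) =
      J (e₁ + t • e₂ + r • e₃) e₁ * (1 + F t * t' + G r * r') := fun t r t' r' => by
    rw [map_add, map_add, map_smul, map_smul, coordF, coordG, smul_eq_mul, smul_eq_mul]; ring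
  have H : ∀ t r t' r', 1 + F t * t' + G r * r' = 0 → 1 + F t' * t + G r' * r = 0 := by
    intro t r t' r' h
    have := hs _ _ (ne0 t r) (ne0 t' r') (by rw [expand, h, mul_zero])
    rw [expand] at this
    exact (mul_eq_zero.1 this).resolve_left (first _ _)
  have hF0 : F 0 = 0 := by simp [hFdef, h₁₂]
  have hG0 : G 0 = 0 := by simp [hGdef, h₁₃]
  have hF : ∀ t, F t = 0 → t = 0 := fun t h => by
    have h := hs _ _ (n2 t) h₂ ((div_eq_zero_iff.1 h).resolve_right (f2 t))
    simpa [h₂₁, hJ _ h₂] using h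
  have hG : ∀ t, G t = 0 → t = 0 := fun t h => by
    have h := hs _ _ (n3 t) h₃ ((div_eq_zero_iff.1 h).resolve_right (f3 t))
    simpa [h₃₁, hJ _ h₃] using h
  have lin := linear_of_symm_relation hF0 hG0 hF hG H
  refine ⟨F 1, ?_, fun t a b h => ?_⟩
  -- A negative coefficient would produce an isotropic vector, contrary to `hJ`.
  · by_contra hneg
    have hc : F 1 ≠ 0 := fun h => one_ne_zero (hF 1 h)
    have hlt : F 1 < 0 := lt_of_le_of_ne (not_lt.1 hneg) hc
    have hpos : 0 < -(F 1)⁻¹ := by simpa using hlt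
    set t := √(-(F 1)⁻¹) with ht
    have htt : t * t = -(F 1)⁻¹ := Real.mul_self_sqrt hpos.le
    have h0 := expand t 0 t 0
    have h1 : 1 + F t * t + G 0 * 0 = 0 := by
      rw [lin t, mul_assoc, htt]; field_simp; ring
    rw [h1, mul_zero] at h0
    exact hJ _ (ne0 t 0) h0
  · have h2 := coordF t 0
    rw [zero_smul, add_zero] at h2
    rw [map_add, map_smul, map_smul, h2, lin t, smul_eq_mul, smul_eq_mul]
    linear_combination J (e₁ + t • e₂) e₁ * h

end Polarity

/-! ### Rotation invariance from tangent inequalities. -/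

section Plane

/-- Since `(1 + iθ/n)^n → exp (iθ)`, tangent steps accumulate to a rotation, so no rotation
decreases `N`. Opposite rotations then give equality. -/
theorem eq_norm_mul_of_le_tangent {N : ℂ → ℝ} (hN : Continuous N)
    (hs : ∀ (r : ℝ) z, N (r * z) = |r| * N z)
    (ht : ∀ z (t : ℝ), N z ≤ N (z * (1 + t * Complex.I))) (z : ℂ) : N z = ‖z‖ * N 1 := by
  have step : ∀ (t : ℝ) (n : ℕ) z, N z ≤ N (z * (1 + t * Complex.I) ^ n) := by
    intro t n
    induction n with
    | zero => intro z; simp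
    | succ n ih =>
      intro z
      refine (ih z).trans ((ht _ t).trans_eq ?_)
      rw [pow_succ, mul_assoc]
  have rot : ∀ (θ : ℝ) z, N z ≤ N (z * Complex.exp (θ * Complex.I)) := by
    intro θ z
    have h1 : Tendsto (fun n : ℕ => N (z * (1 + (θ * Complex.I) / n) ^ n)) atTop
        (𝓝 (N (z * Complex.exp (θ * Complex.I)))) :=
      (hN.tendsto _).comp ((Complex.tendsto_one_add_div_pow_exp _).const_mul z)
    refine ge_of_tendsto' h1 fun n => ?_
    have h2 := step (θ / n) n z
    rwa [Complex.ofReal_div, Complex.ofReal_natCast, div_mul_eq_mul_div] at h2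
  have h := Complex.norm_mul_exp_arg_mul_I z
  have h1 : N ((‖z‖ : ℂ)) = ‖z‖ * N 1 := by
    have := hs ‖z‖ 1
    rwa [mul_one, abs_norm] at this
  rw [← h1]
  apply le_antisymm
  · have := rot (-z.arg) z
    nth_rewrite 2 [← h] at this
    rw [mul_assoc, ← Complex.exp_add] at this
    simpa using this
  · have := rot z.arg ‖z‖
    rwa [h] at this

end Plane

/-! ### Bicontractive pairs and their limits. -/

section Pairs

variable {Y : Type*} [NormedAddCommGroup Y] [NormedSpace ℝ Y]

/-- The vector `e` and the functional `φ` define the bicontractive projection `z ↦ φ z • e`. -/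
structure IsBicontractivePair (e : Y) (φ : StrongDual ℝ Y) : Prop where
  norm_eq : ‖e‖ = 1
  apply_self : φ e = 1
  norm_le : ‖φ‖ ≤ 1
  contractive : ∀ z, ‖z - φ z • e‖ ≤ ‖z‖

/-- The isometry of the dual given by composition with a linear isometry. -/
def dualIsometry (T : Y ≃ₗᵢ[ℝ] Y) : StrongDual ℝ Y ≃ₗᵢ[ℝ] StrongDual ℝ Y where
  toFun φ := φ.comp (T.toContinuousLinearEquiv : Y →L[ℝ] Y)
  invFun φ := φ.comp (T.symm.toContinuousLinearEquiv : Y →L[ℝ] Y)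
  map_add' _ _ := rfl
  map_smul' _ _ := rfl
  left_inv φ := by ext; simp
  right_inv φ := by ext; simp
  norm_map' φ := ContinuousLinearMap.opNorm_comp_linearIsometryEquiv φ T

@[simp]
theorem dualIsometry_apply (T : Y ≃ₗᵢ[ℝ] Y) (φ : StrongDual ℝ Y) (z : Y) :
    dualIsometry T φ z = φ (T z) := rfl

theorem apply_le_norm {φ : StrongDual ℝ Y} (h : ‖φ‖ ≤ 1) (z : Y) : |φ z| ≤ ‖z‖ := by
  simpa using φ.le_of_opNorm_le h z

theorem IsBicontractivePair.map {e : Y} {φ : StrongDual ℝ Y} (h : IsBicontractivePair e φ)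
    (T : Y ≃ₗᵢ[ℝ] Y) : IsBicontractivePair (T.symm e) (dualIsometry T φ) where
  norm_eq := by simpa using h.norm_eq
  apply_self := by simpa using h.apply_self
  norm_le := by simpa using h.norm_le
  contractive z := by
    have := h.contractive (T z)
    rw [T.norm_map, ← T.symm.norm_map] at this
    simpa using this

theorem exists_weakStar_limit (φ : ℕ → StrongDual ℝ Y) (h : ∀ n, ‖φ n‖ ≤ 1) :
    ∃ ψ : StrongDual ℝ Y, ‖ψ‖ ≤ 1 ∧
      ∀ z, Tendsto (fun n => φ n z) (hyperfilter ℕ : Filter ℕ) (𝓝 (ψ z)) := by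
  have hc := isCompact_iff_ultrafilter_le_nhds.1
    (WeakDual.isCompact_closedBall (𝕜 := ℝ) (0 : StrongDual ℝ Y) 1)
  obtain ⟨ψ, hψ, hle⟩ := hc ((hyperfilter ℕ).map fun n => StrongDual.toWeakDual (φ n)) (by
    rw [le_principal_iff]
    refine Filter.mem_map.2 (Filter.univ_mem' fun n => ?_)
    simpa using h n)
  refine ⟨WeakDual.toStrongDual ψ, by simpa using hψ, fun z => ?_⟩
  have : Tendsto (fun n => StrongDual.toWeakDual (φ n)) (hyperfilter ℕ : Filter ℕ) (𝓝 ψ) := hle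
  exact ((WeakDual.eval_continuous z).tendsto ψ).comp this

theorem exists_bicontractivePair {e : Y} {φ : StrongDual ℝ Y} (h : IsBicontractivePair e φ)
    (hd : ∀ y : Y, ‖y‖ = 1 → ∀ ε > 0, ∃ T : Y ≃ₗᵢ[ℝ] Y, ‖T e - y‖ < ε) {y : Y} (hy : ‖y‖ = 1) :
    ∃ ψ, IsBicontractivePair y ψ := by
  choose T hT using fun n : ℕ => hd y hy (1 / ((n : ℝ) + 1)) Nat.one_div_pos_of_nat
  have hlim : Tendsto (fun n => T n e) (hyperfilter ℕ : Filter ℕ) (𝓝 y) := by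
    refine Tendsto.mono_left ?_ Nat.hyperfilter_le_atTop
    refine tendsto_iff_norm_sub_tendsto_zero.2 ?_
    exact squeeze_zero (fun _ => norm_nonneg _) (fun n => (hT n).le)
      tendsto_one_div_add_atTop_nhds_zero_nat
  have hp := fun n => h.map (T n).symm
  simp only [LinearIsometryEquiv.symm_symm] at hp
  obtain ⟨ψ, hψ, hψl⟩ := exists_weakStar_limit _ fun n => (hp n).norm_le
  refine ⟨ψ, hy, ?_, hψ, fun z => ?_⟩
  · have h1 : Tendsto (fun n => dualIsometry (T n).symm φ y) (hyperfilter ℕ : Filter ℕ) (𝓝 1) := by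
      have h2 : Tendsto (fun n => 1 - ‖T n e - y‖) (hyperfilter ℕ : Filter ℕ) (𝓝 1) := by
        have := (tendsto_iff_norm_sub_tendsto_zero.1 hlim).const_sub 1
        simpa using this
      refine tendsto_of_tendsto_of_tendsto_of_le_of_le h2 tendsto_const_nhds (fun n => ?_)
        fun n => ?_
      · have h3 := (abs_le.1 (apply_le_norm (hp n).norm_le (T n e - y))).2
        rw [map_sub, (hp n).apply_self] at h3
        show 1 - ‖T n e - y‖ ≤ _
        linarith
      · have := (abs_le.1 (apply_le_norm (hp n).norm_le y)).2
        rwa [hy] at this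
    exact tendsto_nhds_unique (hψl y) h1
  · have h1 := (tendsto_const_nhds (x := z)).sub ((hψl z).smul hlim)
    exact le_of_tendsto' h1.norm fun n => (hp n).contractive z

end Pairs

/-! ### Symmetric orthogonality in infinite dimension. -/

section InfiniteDimensional

variable {Y : Type*} [NormedAddCommGroup Y] [NormedSpace ℝ Y]

variable {J : Y → StrongDual ℝ Y}

theorem norm_smul_le_of_apply_eq_zero
    (hJ : ∀ y, y ≠ 0 → IsBicontractivePair (‖y‖⁻¹ • y) (J y)) {y z : Y} (hy : y ≠ 0)
    (h : J y z = 0) (a s : ℝ) : ‖a • y‖ ≤ ‖a • y + s • z‖ := by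
  have h1 := (hJ y hy).apply_self
  have hn := norm_ne_zero_iff.2 hy
  rw [map_smul, smul_eq_mul, inv_mul_eq_one₀ hn] at h1
  have h2 := apply_le_norm (hJ y hy).norm_le (a • y + s • z)
  rw [map_add, map_smul, map_smul, h, smul_zero, add_zero, ← h1, smul_eq_mul, abs_mul,
    abs_norm] at h2
  rwa [norm_smul, Real.norm_eq_abs]

theorem norm_smul_le_of_apply_eq_zero'
    (hJ : ∀ y, y ≠ 0 → IsBicontractivePair (‖y‖⁻¹ • y) (J y)) {y z : Y} (hy : y ≠ 0)
    (h : J y z = 0) (a s : ℝ) : ‖a • z‖ ≤ ‖a • z + s • y‖ := by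
  have h1 := (hJ y hy).apply_self
  have hn := norm_ne_zero_iff.2 hy
  rw [map_smul, smul_eq_mul, inv_mul_eq_one₀ hn] at h1
  have h2 := (hJ y hy).contractive (a • z + s • y)
  rw [map_add, map_smul, map_smul, h, smul_zero, zero_add, ← h1, smul_smul, smul_eq_mul,
    mul_inv_cancel_right₀ hn, add_sub_cancel_right] at h2
  exact h2

theorem apply_self_eq_norm (hJ : ∀ y, y ≠ 0 → IsBicontractivePair (‖y‖⁻¹ • y) (J y)) {y : Y}
    (hy : y ≠ 0) : J y y = ‖y‖ := by
  have h1 := (hJ y hy).apply_self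
  rw [map_smul, smul_eq_mul, inv_mul_eq_one₀ (norm_ne_zero_iff.2 hy)] at h1
  exact h1.symm

/-- If `c = J z y ≠ 0`, a whole segment of vectors `y - (c * r / ‖z‖) • z` would be orthogonal to
`z`. Since they differ by multiples of `z`, their norms all agree, which strict convexity forbids.
-/
theorem apply_eq_zero_symm [StrictConvexSpace ℝ Y]
    (hJ : ∀ y, y ≠ 0 → IsBicontractivePair (‖y‖⁻¹ • y) (J y)) {y z : Y} (hy : y ≠ 0) (hz : z ≠ 0)
    (h : J y z = 0) : J z y = 0 := by
  by_contra hc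
  set c := J z y with hcdef
  have hn : 0 < ‖z‖ := norm_pos_iff.2 hz
  have hzz := apply_self_eq_norm hJ hz
  have claim : ∀ r : ℝ, 0 < r → r < 1 →
      y - (c * r / ‖z‖) • z ≠ 0 ∧ J (y - (c * r / ‖z‖) • z) z = 0 := by
    intro r hr0 hr1
    set v := y - (c * r / ‖z‖) • z with hv
    have hJv : J z v = c * (1 - r) := by
      rw [hv, map_sub, map_smul, hzz, ← hcdef, smul_eq_mul]; field_simp
    have hv0 : v ≠ 0 := fun h0 => by
      rw [h0, map_zero] at hJv
      exact mul_ne_zero hc (by linarith : (1 - r) ≠ 0) hJv.symm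
    refine ⟨hv0, ?_⟩
    by_contra ha
    have hvn : 0 < ‖v‖ := norm_pos_iff.2 hv0
    have hle := (hJ v hv0).contractive z
    set t := -(J v z / ‖v‖) with ht
    have ht0 : t ≠ 0 := neg_ne_zero.2 (div_ne_zero ha hvn.ne')
    have heq : z - J v z • ‖v‖⁻¹ • v = z + t • v := by
      rw [ht, smul_smul, neg_smul, div_eq_mul_inv, sub_eq_add_neg]
    rw [heq] at hle
    -- Moving from `z` along `v` strictly increases the norm: `J y z = 0` shows it for one sign of
    -- `t * c`, the functional `J z` for the other. This contradicts `hle`.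
    rcases lt_or_gt_of_ne (mul_ne_zero ht0 hc) with hneg | hpos
    · have h1 := norm_smul_le_of_apply_eq_zero' hJ hy h (1 - t * (c * r / ‖z‖)) t
      have h2 : (1 - t * (c * r / ‖z‖)) • z + t • y = z + t • v := by
        rw [hv]; module
      rw [h2, norm_smul, Real.norm_eq_abs] at h1
      have h3 : t * (c * r / ‖z‖) < 0 := by
        have : t * (c * r / ‖z‖) = t * c * (r / ‖z‖) := by ring
        rw [this]
        exact mul_neg_of_neg_of_pos hneg (by positivity)
      have h4 : 1 < |1 - t * (c * r / ‖z‖)| := lt_of_lt_of_le (by linarith) (le_abs_self _)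
      nlinarith
    · have h1 := (abs_le.1 (apply_le_norm (hJ z hz).norm_le (z + t • v))).2
      rw [map_add, map_smul, hJv, hzz, smul_eq_mul] at h1
      have : 0 < t * c * (1 - r) := mul_pos hpos (by linarith)
      nlinarith
  obtain ⟨hv, hvz⟩ := claim (1 / 2) (by norm_num) (by norm_num)
  obtain ⟨hw, hwz⟩ := claim (1 / 3) (by norm_num) (by norm_num)
  set v := y - (c * (1 / 2) / ‖z‖) • z with hvdef
  set w := y - (c * (1 / 3) / ‖z‖) • z with hwdef
  have hwv : w = v + (c / 6 / ‖z‖) • z := by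
    rw [hvdef, hwdef]; module
  have hvw : v = w + (-(c / 6 / ‖z‖)) • z := by rw [hwv]; module
  have e1 : ‖v‖ = ‖w‖ := by
    apply le_antisymm
    · have := norm_smul_le_of_apply_eq_zero hJ hv hvz 1 (c / 6 / ‖z‖)
      rwa [one_smul, ← hwv] at this
    · have := norm_smul_le_of_apply_eq_zero hJ hw hwz 1 (-(c / 6 / ‖z‖))
      rwa [one_smul, ← hvw] at this
  have e2 : ‖v + w‖ = ‖v‖ + ‖w‖ := by
    apply le_antisymm (norm_add_le _ _)
    have := norm_smul_le_of_apply_eq_zero hJ hv hvz 2 (c / 6 / ‖z‖)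
    rw [norm_smul, two_smul, add_assoc, ← hwv] at this
    rw [← e1]
    norm_num at this
    linarith
  have e3 := eq_of_norm_eq_of_norm_add_eq e1 e2
  rw [hwv, left_eq_add, smul_eq_zero] at e3
  rcases e3 with e3 | e3
  · exact div_ne_zero (div_ne_zero hc (by norm_num)) hn.ne' e3
  · exact hz e3

theorem exists_norm_sq_eq [StrictConvexSpace ℝ Y]
    (hJ : ∀ y, y ≠ 0 → IsBicontractivePair (‖y‖⁻¹ • y) (J y)) {e₁ e₂ e₃ : Y}
    (h₁ : e₁ ≠ 0) (h₂ : e₂ ≠ 0) (h₃ : e₃ ≠ 0)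
    (h₁₂ : J e₁ e₂ = 0) (h₁₃ : J e₁ e₃ = 0) (h₂₃ : J e₂ e₃ = 0) :
    ∃ c k : ℝ, ∀ a b : ℝ, ‖a • e₁ + b • e₂‖ * ‖a • e₁ + b • e₂‖ = k * (a * a + c * (b * b)) := by
  have hs := fun y z (hy : y ≠ 0) (hz : z ≠ 0) h => apply_eq_zero_symm hJ hy hz h
  obtain ⟨c, hc, hform⟩ := exists_diagonal_form (J := fun y => (J y).toLinearMap)
    (fun y hy => by
      show J y y ≠ 0
      rw [apply_self_eq_norm hJ hy]; exact norm_ne_zero_iff.2 hy) hs h₁ h₂ h₃ h₁₂ h₁₃ h₂₃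
  have hsc : 0 < √c := Real.sqrt_pos.2 hc
  -- Scaling by `√c` turns the diagonal form into the Euclidean one, so orthogonal directions become
  -- Euclidean tangents.
  set N : ℂ → ℝ := fun z => ‖z.re • e₁ + (z.im / √c) • e₂‖ with hN
  have hcont : Continuous N := by rw [hN]; fun_prop
  have hhom : ∀ (r : ℝ) z, N (r * z) = |r| * N z := fun r z => by
    simp only [hN, Complex.re_ofReal_mul, Complex.im_ofReal_mul]
    rw [← Real.norm_eq_abs, ← norm_smul]
    congr 1; module
  have ht : ∀ z (t : ℝ), N z ≤ N (z * (1 + t * Complex.I)) := by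
    intro z t
    obtain ⟨a, b⟩ := z
    have hre : (⟨a, b⟩ * (1 + t * Complex.I) : ℂ).re = a - t * b := by simp; ring
    have him : (⟨a, b⟩ * (1 + t * Complex.I) : ℂ).im = b + t * a := by simp; ring
    simp only [hN, hre, him]
    rcases eq_or_ne a 0 with rfl | ha
    · have := norm_smul_le_of_apply_eq_zero hJ h₂ (hs _ _ h₁ h₂ h₁₂) (b / √c) (-(t * b))
      convert this using 2 <;> module
    · have hq := hform (b / (a * √c)) (-b) (a / √c) (by
        field_simp
        rw [Real.sq_sqrt hc.le]; ring)
      have hq0 : e₁ + (b / (a * √c)) • e₂ ≠ 0 := fun h0 => by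
        have h3 : J e₁ (e₁ + (b / (a * √c)) • e₂) = 0 := by rw [h0, map_zero]
        rw [map_add, map_smul, h₁₂, smul_zero, add_zero, apply_self_eq_norm hJ h₁] at h3
        exact norm_ne_zero_iff.2 h₁ h3
      have := norm_smul_le_of_apply_eq_zero hJ hq0 hq a t
      have e4 : a * (b / (a * √c)) = b / √c := by field_simp
      convert this using 2
      · rw [smul_add, smul_smul, e4]
      · rw [smul_add, smul_smul, e4]; module
  have hfin := eq_norm_mul_of_le_tangent hcont hhom ht
  refine ⟨c, N 1 * N 1, fun a b => ?_⟩
  have h5 := hfin ⟨a, b * √c⟩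
  have h6 : N ⟨a, b * √c⟩ = ‖a • e₁ + b • e₂‖ := by
    simp only [hN]; rw [mul_div_cancel_right₀ _ hsc.ne']
  rw [← h6, h5]
  have h7 : ‖(⟨a, b * √c⟩ : ℂ)‖ * ‖(⟨a, b * √c⟩ : ℂ)‖ = a * a + c * (b * b) := by
    rw [Complex.norm_mul_self_eq_normSq, Complex.normSq_mk]
    linear_combination (b * b) * Real.mul_self_sqrt hc.le
  linear_combination N 1 * N 1 * h7

theorem parallelogram_of_infiniteDimensional [StrictConvexSpace ℝ Y]
    (hJ : ∀ y, y ≠ 0 → IsBicontractivePair (‖y‖⁻¹ • y) (J y)) (hfin : ¬ FiniteDimensional ℝ Y)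
    (x y : Y) : ‖x + y‖ * ‖x + y‖ + ‖x - y‖ * ‖x - y‖ = 2 * (‖x‖ * ‖x‖ + ‖y‖ * ‖y‖) := by
  rcases eq_or_ne x 0 with rfl | hx
  · simp; ring
  have hxn := norm_ne_zero_iff.2 hx
  set β := J x y / ‖x‖ with hβ
  set e := y - β • x with he
  have hy : y = β • x + e := by rw [he]; module
  have hxx := apply_self_eq_norm hJ hx
  have hxe : J x e = 0 := by
    rw [he, map_sub, map_smul, hxx, hβ, smul_eq_mul]; field_simp; ring
  rcases eq_or_ne e 0 with he0 | he0
  · rw [he0, add_zero] at hy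
    have a1 : x + y = (1 + β) • x := by rw [hy]; module
    have a2 : x - y = (1 - β) • x := by rw [hy]; module
    rw [a1, a2, hy]
    simp only [norm_smul, Real.norm_eq_abs]
    linear_combination (‖x‖ * ‖x‖) *
      (abs_mul_abs_self (1 + β) + abs_mul_abs_self (1 - β) - 2 * abs_mul_abs_self β)
  -- Infinite dimension serves only to supply a third direction, made orthogonal to `x` and `e`
  -- below.
  obtain ⟨w, hw⟩ : ∃ w, w ∉ Submodule.span ℝ {x, e} := by
    by_contra! hall
    apply hfin
    have htop : Submodule.span ℝ {x, e} = ⊤ := Submodule.eq_top_iff'.2 hall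
    exact Module.finite_def.2 (htop ▸ Submodule.fg_span (Set.toFinite _))
  have hen := norm_ne_zero_iff.2 he0
  have hee := apply_self_eq_norm hJ he0
  have hex := apply_eq_zero_symm hJ hx he0 hxe
  set v := w - (J x w / ‖x‖) • x - (J e w / ‖e‖) • e with hv
  have hv0 : v ≠ 0 := fun h0 => hw (by
    have : w = (J x w / ‖x‖) • x + (J e w / ‖e‖) • e := by
      rw [← sub_eq_zero, ← h0, hv]; module
    exact Submodule.mem_span_pair.2 ⟨_, _, this.symm⟩)
  have hxv : J x v = 0 := by
    rw [hv, map_sub, map_sub, map_smul, map_smul, hxx, hxe, smul_eq_mul]; field_simp; simp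
  have hev : J e v = 0 := by
    rw [hv, map_sub, map_sub, map_smul, map_smul, hee, hex, smul_eq_mul, smul_eq_mul]
    field_simp; simp
  obtain ⟨c, k, hk⟩ := exists_norm_sq_eq hJ hx he0 hv0 hxe hxv hev
  have b1 : x + y = (1 + β) • x + (1 : ℝ) • e := by rw [hy]; module
  have b2 : x - y = (1 - β) • x + (-1 : ℝ) • e := by rw [hy]; module
  have b3 : x = (1 : ℝ) • x + (0 : ℝ) • e := by module
  have b4 : y = β • x + (1 : ℝ) • e := by rw [hy]; module
  have c3 := hk 1 0
  have c4 := hk β 1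
  rw [← b3] at c3
  rw [← b4] at c4
  rw [b1, b2, hk, hk, c3, c4]
  ring

end InfiniteDimensional

/-! ### Invariant quadratic form in finite dimension. -/

section FiniteDimensional

open MeasureTheory

variable {Y : Type*} [NormedAddCommGroup Y] [NormedSpace ℝ Y]

/-- A finite-dimensional space whose rotations have a dense orbit on the unit sphere carries an
invariant quadratic form, the second moment of the dual ball, so that its norm is Euclidean. -/
theorem parallelogram_of_finiteDimensional [FiniteDimensional ℝ Y] {e : Y} (he : ‖e‖ = 1)
    (hd : ∀ y : Y, ‖y‖ = 1 → ∀ ε > 0, ∃ T : Y ≃ₗᵢ[ℝ] Y, ‖T e - y‖ < ε)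
    (x y : Y) : ‖x + y‖ * ‖x + y‖ + ‖x - y‖ * ‖x - y‖ = 2 * (‖x‖ * ‖x‖ + ‖y‖ * ‖y‖) := by
  let _ : MeasurableSpace (StrongDual ℝ Y) := borel _
  have : BorelSpace (StrongDual ℝ Y) := ⟨rfl⟩
  have : ProperSpace Y := FiniteDimensional.proper ℝ Y
  have : ProperSpace (StrongDual ℝ Y) := FiniteDimensional.proper ℝ _
  -- Hausdorff measure is preserved by isometries by construction, and in the top dimension it is a
  -- Haar measure.
  set μ : Measure (StrongDual ℝ Y) := μH[Module.finrank ℝ (StrongDual ℝ Y)] with hμ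
  have : μ.IsAddHaarMeasure := isAddHaarMeasure_hausdorffMeasure
  set B : Set (StrongDual ℝ Y) := Metric.closedBall 0 1 with hB
  have hBc : IsCompact B := isCompact_closedBall _ _
  set Q : Y → ℝ := fun y => ∫ φ in B, φ y * φ y ∂μ with hQ
  have hcont : Continuous Q := by
    refine continuous_parametric_integral_of_continuous (μ := μ) (f := fun y φ => φ y * φ y) ?_ hBc
    have : Continuous fun p : Y × StrongDual ℝ Y => p.2 p.1 := by fun_prop
    exact this.mul this
  have hint : ∀ y, IntegrableOn (fun φ : StrongDual ℝ Y => φ y * φ y) B μ := fun y => by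
    refine ContinuousOn.integrableOn_compact hBc (Continuous.continuousOn ?_)
    fun_prop
  have hinv : ∀ (T : Y ≃ₗᵢ[ℝ] Y) y, Q (T y) = Q y := by
    intro T y
    have hp : MeasurePreserving (dualIsometry T).toIsometryEquiv μ μ :=
      IsometryEquiv.measurePreserving_hausdorffMeasure _ _
    have h1 := hp.setIntegral_preimage_emb
      (dualIsometry T).toHomeomorph.measurableEmbedding (fun φ => φ y * φ y) B
    have h2 : (dualIsometry T).toIsometryEquiv ⁻¹' B = B := by
      ext φ; simp [hB]
    rw [h2] at h1
    exact h1
  have hsmul : ∀ (a : ℝ) y, Q (a • y) = a * a * Q y := fun a y => by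
    simp only [hQ, map_smul, smul_eq_mul, ← integral_const_mul]
    congr 1; ext φ; ring
  have hpar : Q (x + y) + Q (x - y) = 2 * (Q x + Q y) := by
    simp only [hQ]
    rw [← integral_add (hint _) (hint _), ← integral_add (hint _) (hint _), ← integral_const_mul]
    congr 1; ext φ
    rw [map_add, map_sub]; ring
  have hunit : ∀ z, ‖z‖ = 1 → Q z = Q e := fun z hz => by
    choose T hT using fun n : ℕ => hd z hz (1 / ((n : ℝ) + 1)) Nat.one_div_pos_of_nat
    have hlim : Tendsto (fun n => T n e) atTop (𝓝 z) :=
      tendsto_iff_norm_sub_tendsto_zero.2 (squeeze_zero (fun _ => norm_nonneg _)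
        (fun n => (hT n).le) tendsto_one_div_add_atTop_nhds_zero_nat)
    have h1 := (hcont.tendsto z).comp hlim
    have h2 : Q ∘ (fun n => T n e) = fun _ => Q e := funext fun n => hinv _ _
    rw [h2] at h1
    exact tendsto_nhds_unique h1 tendsto_const_nhds
  have hall : ∀ z, Q z = ‖z‖ * ‖z‖ * Q e := fun z => by
    rcases eq_or_ne z 0 with rfl | hz
    · have := hsmul 0 0
      simpa using this
    · have h1 := hunit (‖z‖⁻¹ • z) (norm_smul_inv_norm hz)
      rw [← h1, ← hsmul, smul_inv_smul₀ (norm_ne_zero_iff.2 hz)]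
  have hpos : 0 < Q e := by
    refine (setIntegral_pos_iff_support_of_nonneg_ae
      (Eventually.of_forall fun φ => mul_self_nonneg _) (hint e)).2 ?_
    obtain ⟨g, hg, hge⟩ := exists_dual_vector ℝ e (by rw [he]; exact one_ne_zero)
    have hopen : IsOpen ({φ : StrongDual ℝ Y | φ e ≠ 0} ∩ Metric.ball 0 1) :=
      (isOpen_ne_fun (by fun_prop) continuous_const).inter Metric.isOpen_ball
    refine (hopen.measure_pos μ ⟨(1 / 2 : ℝ) • g, ?_, ?_⟩).trans_le (measure_mono ?_)
    · simp [hge, he]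
    · simp [norm_smul, hg]; norm_num
    · rintro φ ⟨h1, h2⟩
      exact ⟨mul_ne_zero h1 h1, Metric.ball_subset_closedBall h2⟩
  rw [hall (x + y), hall (x - y), hall x, hall y] at hpar
  exact mul_right_cancel₀ hpos.ne' (by linarith)

theorem parallelogram_of_dense_orbit [StrictConvexSpace ℝ Y] {e : Y} {φ : StrongDual ℝ Y}
    (h : IsBicontractivePair e φ)
    (hd : ∀ y : Y, ‖y‖ = 1 → ∀ ε > 0, ∃ T : Y ≃ₗᵢ[ℝ] Y, ‖T e - y‖ < ε)
    (x y : Y) : ‖x + y‖ * ‖x + y‖ + ‖x - y‖ * ‖x - y‖ = 2 * (‖x‖ * ‖x‖ + ‖y‖ * ‖y‖) := by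
  by_cases hfin : FiniteDimensional ℝ Y
  · exact parallelogram_of_finiteDimensional h.norm_eq hd x y
  · have : ∀ y : Y, ∃ ψ, y ≠ 0 → IsBicontractivePair (‖y‖⁻¹ • y) ψ := fun y => by
      by_cases hy : y = 0
      · exact ⟨0, fun h => (h hy).elim⟩
      · obtain ⟨ψ, hψ⟩ := exists_bicontractivePair h hd (norm_smul_inv_norm (𝕜 := ℝ) hy)
        exact ⟨ψ, fun _ => hψ⟩
    choose J hJ using this
    exact parallelogram_of_infiniteDimensional hJ hfin x y

end FiniteDimensional

/-! ### Dichotomy for the orbit of a bicontractive pair. -/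

section Dichotomy

variable {X : Type*} [NormedAddCommGroup X] [NormedSpace ℝ X]

/-- On the kernel of `f`, the contraction `(I - P) (I - Q)` subtracts `g z • (q - f q • p)` and
multiplies the value of `g` by `f q * g p`; iterating gives the geometric sum. -/
theorem norm_sub_geom_sum_le {p q : X} {f g : StrongDual ℝ X} (hp : IsBicontractivePair p f)
    (hq : IsBicontractivePair q g) (n : ℕ) : ∀ z, f z = 0 →
      ‖z - ((∑ k ∈ Finset.range n, (f q * g p) ^ k) * g z) • (q - f q • p)‖ ≤ ‖z‖ := by
  induction n with
  | zero => intro z _; simp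
  | succ n ih =>
    intro z hz
    set m := q - f q • p with hm
    have hfm : f m = 0 := by
      rw [hm, map_sub, map_smul, hp.apply_self, smul_eq_mul, mul_one, sub_self]
    have hgm : g m = 1 - f q * g p := by
      rw [hm, map_sub, map_smul, hq.apply_self, smul_eq_mul]
    have h1 : ‖z - g z • m‖ ≤ ‖z‖ := by
      have h2 := (hp.contractive (z - g z • q)).trans (hq.contractive z)
      have h3 : z - g z • q - f (z - g z • q) • p = z - g z • m := by
        rw [map_sub, map_smul, hz, hm, smul_eq_mul]
        module
      rwa [h3] at h2
    have h3 := ih (z - g z • m) (by rw [map_sub, map_smul, hz, hfm, smul_zero, sub_zero])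
    refine le_trans (le_of_eq ?_) (h3.trans h1)
    rw [geom_sum_succ, map_sub, map_smul, hgm, smul_eq_mul]
    congr 1
    module

/-- If two one-dimensional bicontractive projections are almost mutually normalized and their
ranges are far apart, then the corresponding functionals are close: otherwise the powers of
`(I - P) (I - Q)` would grow. -/
theorem functionals_close {ε d : ℝ} (hε : 0 < ε) (hd : 0 < d) :
    ∃ δ > 0, ∀ (p q : X) (f g : StrongDual ℝ X), IsBicontractivePair p f →
      IsBicontractivePair q g → 1 - δ < f q → 1 - δ < g p → d ≤ ‖q - p‖ →
        ∀ z, |f z - g z| ≤ ε * ‖z‖ := by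
  obtain ⟨n, hn⟩ := exists_nat_gt (16 / (ε * d))
  have hn0 : (0 : ℝ) < n := lt_trans (by positivity) hn
  -- The bounds serve, in order, to keep `r ^ n ≥ 1 / 2` by Bernoulli, absorb the error `(1 - g p) *
  -- f z`, keep `q - f q • p` of norm at least `d / 2`, and keep `r ≥ 0`.
  refine ⟨min (min (1 / (4 * n)) (ε / 2)) (min (d / 2) (1 / 2)), by positivity, ?_⟩
  set δ := min (min (1 / (4 * (n : ℝ))) (ε / 2)) (min (d / 2) (1 / 2)) with hδ
  have d1 : δ ≤ 1 / (4 * n) := (min_le_left _ _).trans (min_le_left _ _)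
  have d2 : δ ≤ ε / 2 := (min_le_left _ _).trans (min_le_right _ _)
  have d3 : δ ≤ d / 2 := (min_le_right _ _).trans (min_le_left _ _)
  have d4 : δ ≤ 1 / 2 := (min_le_right _ _).trans (min_le_right _ _)
  intro p q f g hp hq hfq hgp hpq z
  have u1 : f q ≤ 1 := by
    simpa [hq.norm_eq] using (abs_le.1 (apply_le_norm hp.norm_le q)).2
  have u2 : g p ≤ 1 := by
    simpa [hp.norm_eq] using (abs_le.1 (apply_le_norm hq.norm_le p)).2
  set r := f q * g p with hr
  have hr1 : 1 - 2 * δ ≤ r := by nlinarith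
  have hr0 : 0 ≤ r := by linarith
  have hrle : r ≤ 1 := by nlinarith
  have hδn : n * δ ≤ 1 / 4 := by
    have := mul_le_mul_of_nonneg_left d1 hn0.le
    have h2 : (n : ℝ) * (1 / (4 * n)) = 1 / 4 := by field_simp
    linarith
  have hpow : 1 / 2 ≤ r ^ n := by
    have h1 := one_add_mul_le_pow (a := r - 1) (by linarith) n
    have h2 : 1 + (r - 1) = r := by ring
    rw [h2] at h1
    nlinarith
  have hsum : (n : ℝ) / 2 ≤ ∑ k ∈ Finset.range n, r ^ k := by
    have h1 : ∑ k ∈ Finset.range n, (1 / 2 : ℝ) ≤ ∑ k ∈ Finset.range n, r ^ k :=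
      Finset.sum_le_sum fun k hk =>
        hpow.trans (pow_le_pow_of_le_one hr0 hrle (Finset.mem_range.1 hk).le)
    simpa [div_eq_mul_inv] using h1
  have hm : d / 2 ≤ ‖q - f q • p‖ := by
    have h1 : q - p = (q - f q • p) - (1 - f q) • p := by module
    have h2 := norm_sub_le (q - f q • p) ((1 - f q) • p)
    rw [← h1, norm_smul, hp.norm_eq, mul_one, Real.norm_eq_abs, abs_of_nonneg (by linarith)] at h2
    linarith
  set w := z - f z • p with hw
  have hfw : f w = 0 := by
    rw [hw, map_sub, map_smul, hp.apply_self, smul_eq_mul, mul_one, sub_self]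
  have hgw : g w = g z - f z * g p := by rw [hw, map_sub, map_smul, smul_eq_mul]
  have hwz : ‖w‖ ≤ ‖z‖ := hp.contractive z
  have hmain := norm_sub_geom_sum_le hp hq n w hfw
  set s := ∑ k ∈ Finset.range n, r ^ k with hs
  have h4 : ‖(s * g w) • (q - f q • p)‖ ≤ 2 * ‖z‖ := by
    have h5 := norm_sub_le w (w - (s * g w) • (q - f q • p))
    rw [sub_sub_cancel] at h5
    linarith
  have hs0 : 0 < s := lt_of_lt_of_le (by positivity) hsum
  rw [norm_smul, Real.norm_eq_abs, abs_mul, abs_of_pos hs0] at h4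
  have h6 : (n : ℝ) / 2 * (d / 2) * |g w| ≤ 2 * ‖z‖ := by
    refine le_trans ?_ h4
    have : (n : ℝ) / 2 * (d / 2) ≤ s * ‖q - f q • p‖ := by gcongr
    nlinarith [abs_nonneg (g w)]
  have h7 : 16 < n * (ε * d) := by rwa [div_lt_iff₀ (by positivity)] at hn
  have h8 : |g w| ≤ ε / 2 * ‖z‖ := by
    by_contra hcon
    have h9 : (n : ℝ) / 2 * (d / 2) * (ε / 2 * ‖z‖) < n / 2 * (d / 2) * |g w| :=
      mul_lt_mul_of_pos_left (not_le.1 hcon) (by positivity)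
    nlinarith [norm_nonneg z]
  have h10 : |f z| ≤ ‖z‖ := apply_le_norm hp.norm_le z
  have h11 : f z - g z = (1 - g p) * f z - g w := by rw [hgw]; ring
  rw [h11]
  refine (abs_sub _ _).trans ?_
  rw [abs_mul, abs_of_nonneg (by linarith : 0 ≤ 1 - g p)]
  have h12 : (1 - g p) * |f z| ≤ ε / 2 * ‖z‖ :=
    mul_le_mul (by linarith) h10 (abs_nonneg _) (by linarith)
  linarith

/-- Suppose `T` moves `x` far and `S` moves `f` far. The pairs at `x`, `S.symm x` and `T x` are
almost mutually normalized. If `S.symm x` is far from `x`, then `f ∘ S` is close to `f`. Otherwise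
`T x` is far from both points, so `f ∘ T.symm` is close to both functionals. Either way `S` cannot
move `f` far. -/
theorem orbit_dichotomy {x : X} {f : StrongDual ℝ X} (h : IsBicontractivePair x f)
    (hW : ∀ ε > 0, ∃ δ > 0, ∀ z, ‖z‖ ≤ 1 → 2 - δ < ‖x + z‖ → 1 - ε < f z) :
    (∀ ε > 0, ∃ δ > 0, ∀ T : X ≃ₗᵢ[ℝ] X, 1 - δ < f (T x) → ‖T x - x‖ ≤ ε) ∨
    ∀ ε > 0, ∃ δ > 0, ∀ T : X ≃ₗᵢ[ℝ] X, 1 - δ < f (T x) → ∀ z, |f (T z) - f z| ≤ ε * ‖z‖ := by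
  by_contra! hcon
  obtain ⟨⟨d, hd, hT⟩, ε, hε, hS⟩ := hcon
  obtain ⟨δ₁, hδ₁, hclose⟩ := functionals_close (X := X) (half_pos hε) (half_pos hd)
  obtain ⟨δ₂, hδ₂, hW₁⟩ := hW δ₁ hδ₁
  obtain ⟨δ₃, hδ₃, hW₂⟩ := hW (min δ₁ (δ₂ / 2)) (by positivity)
  have hadd : ∀ u v : X, f u + f v ≤ ‖u + v‖ := fun u v => by
    rw [← map_add]; exact (abs_le.1 (apply_le_norm h.norm_le _)).2
  have hsymm : ∀ R : X ≃ₗᵢ[ℝ] X, 1 - δ₃ < f (R x) → 1 - min δ₁ (δ₂ / 2) < f (R.symm x) := by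
    intro R hR
    refine hW₂ _ (by simp [h.norm_eq]) ?_
    rw [← R.norm_map, map_add, R.apply_symm_apply]
    have := hadd (R x) x
    rw [h.apply_self] at this
    linarith
  obtain ⟨T, hT1, hT2⟩ := hT (min δ₃ (min δ₁ (δ₂ / 2))) (by positivity)
  obtain ⟨S, hS1, z, hS2⟩ := hS (min δ₃ (min δ₁ (δ₂ / 2))) (by positivity)
  have m1 : min δ₃ (min δ₁ (δ₂ / 2)) ≤ δ₃ := min_le_left _ _
  have m2 : min δ₃ (min δ₁ (δ₂ / 2)) ≤ min δ₁ (δ₂ / 2) := min_le_right _ _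
  have m3 : min δ₁ (δ₂ / 2) ≤ δ₁ := min_le_left _ _
  have m4 : min δ₁ (δ₂ / 2) ≤ δ₂ / 2 := min_le_right _ _
  have hTs := hsymm T (by linarith)
  have hSs := hsymm S (by linarith)
  have pS := h.map S
  have pT := h.map T.symm
  rw [LinearIsometryEquiv.symm_symm] at pT
  by_cases hfar : d / 2 ≤ ‖S.symm x - x‖
  · have := hclose _ _ _ _ h pS (by linarith) (by rw [dualIsometry_apply]; linarith) hfar z
    rw [dualIsometry_apply, abs_sub_comm] at this
    nlinarith [norm_nonneg z]
  · have c1 := hclose _ _ _ _ h pT (by linarith) (by rw [dualIsometry_apply]; linarith)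
      (by linarith) z
    have hST : 2 - δ₂ < ‖S.symm x + T x‖ := by
      have := hadd (S.symm x) (T x)
      linarith
    have g1 : 1 - δ₁ < f (S (T x)) := by
      refine hW₁ _ (by simp [h.norm_eq]) ?_
      rwa [← S.symm.norm_map, map_add, S.symm_apply_apply]
    have g2 : 1 - δ₁ < f (T.symm (S.symm x)) := by
      refine hW₁ _ (by simp [h.norm_eq]) ?_
      rwa [← T.norm_map, map_add, T.apply_symm_apply, add_comm]
    have hdist : d / 2 ≤ ‖T x - S.symm x‖ := by
      have h1 : T x - x = (T x - S.symm x) + (S.symm x - x) := by abel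
      have h2 := norm_add_le (T x - S.symm x) (S.symm x - x)
      rw [← h1] at h2
      linarith
    have c2 := hclose _ _ _ _ pS pT (by rwa [dualIsometry_apply])
      (by rwa [dualIsometry_apply]) hdist z
    rw [dualIsometry_apply] at c1 c2
    rw [dualIsometry_apply] at c2
    have h3 : f (S z) - f z = (f (S z) - f (T.symm z)) - (f z - f (T.symm z)) := by ring
    rw [h3] at hS2
    have := abs_sub (f (S z) - f (T.symm z)) (f z - f (T.symm z))
    linarith

end Dichotomy

/-! ### Exposing functionals, density of orbits and duality. -/

section Transfer

variable {X : Type*} [NormedAddCommGroup X] [NormedSpace ℝ X]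

theorem IsBigPoint.mem_of_orbit_subset {x : X} (hx : IsBigPoint x) {S : Set X} (hS : IsClosed S)
    (hconv : Convex ℝ S) (horb : ∀ T : X ≃ₗᵢ[ℝ] X, T x ∈ S) {z : X} (hz : ‖z‖ ≤ 1) : z ∈ S := by
  have h1 : z ∈ Metric.closedBall (0 : X) 1 := by simpa using hz
  rw [← hx.2] at h1
  exact closure_minimal (convexHull_min (Set.range_subset_iff.2 horb) hconv) hS h1

theorem IsBigPoint.exists_lt_apply {x : X} (hx : IsBigPoint x) (φ : StrongDual ℝ X) {z : X}
    (hz : ‖z‖ ≤ 1) {a : ℝ} (ha : a < φ z) : ∃ T : X ≃ₗᵢ[ℝ] X, a < φ (T x) := by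
  by_contra! hcon
  have := hx.mem_of_orbit_subset (S := {w | φ w ≤ a})
    (isClosed_le φ.continuous continuous_const)
    (convex_halfSpace_le φ.toLinearMap.isLinear a) hcon hz
  exact absurd ha (not_lt.2 this)

theorem exists_lt_apply_of_lt_norm (hX : IsConvexTransitive X) {x : X} (hx : ‖x‖ = 1)
    {φ : StrongDual ℝ X} {a : ℝ} (ha : a < ‖φ‖) :
    ∃ T : X ≃ₗᵢ[ℝ] X, a < φ (T x) := by
  obtain ⟨z, hz, hza⟩ := φ.exists_lt_apply_of_lt_opNorm ha
  rcases lt_abs.1 hza with h | h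
  · exact (hX x hx).exists_lt_apply φ hz.le h
  · exact (hX x hx).exists_lt_apply φ (z := -z) (by simpa using hz.le) (by simpa using h)

theorem exists_bicontractivePair_of_isBicontractiveProjection
    (hP : ∃ (L : Submodule ℝ X) (P : X →L[ℝ] X),
      Module.finrank ℝ L = 1 ∧ IsBicontractiveProjection P L) :
    ∃ (e : X) (φ : StrongDual ℝ X), IsBicontractivePair e φ := by
  obtain ⟨L, P, hL, hproj, hPn, hQn⟩ := hP
  obtain ⟨⟨v, hvL⟩, hv0, hv⟩ := finrank_eq_one_iff'.1 hL
  have hv0' : v ≠ 0 := fun h => hv0 (Subtype.ext h)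
  have hvn := norm_ne_zero_iff.2 hv0'
  set e := ‖v‖⁻¹ • v with he
  have hen : ‖e‖ = 1 := norm_smul_inv_norm (𝕜 := ℝ) hv0'
  have heL : e ∈ L := L.smul_mem _ hvL
  obtain ⟨ψ, hψ, hψe⟩ := exists_dual_vector ℝ e (by rw [hen]; exact one_ne_zero)
  rw [hen] at hψe
  have hψe : ψ e = 1 := hψe
  have hPe : P e = e := hproj.map_id e heL
  have hPz : ∀ z, P z = ψ (P z) • e := fun z => by
    obtain ⟨c, hc⟩ := hv ⟨P z, hproj.map_mem z⟩
    have hc : c • v = P z := congrArg Subtype.val hc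
    have h1 : P z = (c * ‖v‖) • e := by
      rw [he, smul_smul, mul_inv_cancel_right₀ hvn, hc]
    rw [h1, map_smul, hψe, smul_eq_mul, mul_one]
  refine ⟨e, ψ.comp P, hen, ?_, ?_, fun z => ?_⟩
  · rw [ContinuousLinearMap.comp_apply, hPe, hψe]
  · refine (ψ.opNorm_comp_le P).trans ?_
    rw [hψ, hPn, one_mul]
  · rw [ContinuousLinearMap.comp_apply, ← hPz]
    have := (ContinuousLinearMap.id ℝ X - P).le_opNorm z
    rwa [hQn, one_mul] at this

theorem IsWeakLURPoint.tendsto_apply {x : X} (hx : IsWeakLURPoint x) {u : ℕ → X}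
    (hu : ∀ n, ‖u n‖ ≤ 1) (hl : Tendsto (fun n => ‖x + u n‖) atTop (𝓝 2)) (g : StrongDual ℝ X) :
    Tendsto (fun n => g (u n)) atTop (𝓝 (g x)) :=
  ((WeakBilin.eval_continuous (topDualPairing ℝ X).flip g).tendsto _).comp (hx.2 u hu hl)

theorem IsWeakLURPoint.apply_gt {x : X} (hx : IsWeakLURPoint x) {f : StrongDual ℝ X}
    (hf : f x = 1) : ∀ ε > 0, ∃ δ > 0, ∀ z, ‖z‖ ≤ 1 → 2 - δ < ‖x + z‖ → 1 - ε < f z := by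
  intro ε hε
  by_contra! hcon
  choose u hu1 hu2 hu3 using fun n : ℕ => hcon (1 / ((n : ℝ) + 1)) Nat.one_div_pos_of_nat
  have hl : Tendsto (fun n => ‖x + u n‖) atTop (𝓝 2) := by
    have h1 : Tendsto (fun n : ℕ => (2 : ℝ) - 1 / ((n : ℝ) + 1)) atTop (𝓝 2) := by
      simpa using tendsto_one_div_add_atTop_nhds_zero_nat.const_sub (2 : ℝ)
    refine tendsto_of_tendsto_of_tendsto_of_le_of_le h1 tendsto_const_nhds (fun n => (hu2 n).le)
      fun n => (norm_add_le _ _).trans ?_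
    have := hu1 n
    rw [hx.1]; linarith
  have h2 := hx.tendsto_apply hu1 hl f
  have := le_of_tendsto' h2 hu3
  linarith

/-- Choose `T n` with `φ (T n x) → 1`. Then `‖x + (T n).symm e‖ → 2`, so `(T n).symm e` tends weakly
to `x`. Testing against functionals lets contractivity survive weak limits of vectors paired with
weak-star limits of functionals. -/
theorem exists_bicontractivePair_of_isWeakLURPoint (hX : IsConvexTransitive X) {x e : X}
    (hx : IsWeakLURPoint x) {φ : StrongDual ℝ X} (h : IsBicontractivePair e φ) :
    ∃ f, IsBicontractivePair x f := by
  choose T hT using fun n : ℕ => (hX x hx.1).exists_lt_apply φ h.norm_eq.le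
    (a := 1 - 1 / ((n : ℝ) + 1)) (by
      rw [h.apply_self]
      have : (0 : ℝ) < 1 / ((n : ℝ) + 1) := Nat.one_div_pos_of_nat
      linarith)
  have hp := fun n => h.map (T n)
  have hlow : Tendsto (fun n : ℕ => (1 : ℝ) - 1 / ((n : ℝ) + 1)) atTop (𝓝 1) := by
    simpa using tendsto_one_div_add_atTop_nhds_zero_nat.const_sub (1 : ℝ)
  have hl : Tendsto (fun n => ‖x + (T n).symm e‖) atTop (𝓝 2) := by
    have h1 := hlow.add_const 1
    rw [one_add_one_eq_two] at h1
    refine tendsto_of_tendsto_of_tendsto_of_le_of_le h1 tendsto_const_nhds (fun n => ?_)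
      fun n => (norm_add_le _ _).trans_eq ?_
    · show 1 - 1 / ((n : ℝ) + 1) + 1 ≤ ‖x + (T n).symm e‖
      rw [← (T n).norm_map, map_add, LinearIsometryEquiv.apply_symm_apply]
      have h2 := (abs_le.1 (apply_le_norm h.norm_le (T n x + e))).2
      rw [map_add, h.apply_self] at h2
      linarith [hT n]
    · rw [hx.1, (hp n).norm_eq, one_add_one_eq_two]
  have hweak := hx.tendsto_apply (fun n => (hp n).norm_eq.le) hl
  obtain ⟨f, hf, hfl⟩ := exists_weakStar_limit _ fun n => (hp n).norm_le
  refine ⟨f, hx.1, ?_, hf, fun z => ?_⟩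
  · refine tendsto_nhds_unique (hfl x) (Tendsto.mono_left ?_ Nat.hyperfilter_le_atTop)
    refine tendsto_of_tendsto_of_tendsto_of_le_of_le hlow tendsto_const_nhds
      (fun n => (hT n).le) fun n => ?_
    have := (abs_le.1 (apply_le_norm (hp n).norm_le x)).2
    rwa [hx.1] at this
  · refine NormedSpace.norm_le_dual_bound ℝ _ (norm_nonneg _) fun g => ?_
    have h1 : Tendsto (fun n => ‖g (z - dualIsometry (T n) φ z • (T n).symm e)‖)
        (hyperfilter ℕ : Filter ℕ) (𝓝 ‖g (z - f z • x)‖) := by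
      simp only [map_sub, map_smul]
      exact (tendsto_const_nhds.sub
        ((hfl z).smul ((hweak g).mono_left Nat.hyperfilter_le_atTop))).norm
    refine le_of_tendsto' h1 fun n => ?_
    rw [mul_comm]
    exact g.le_opNorm_of_le ((hp n).contractive z)

theorem strictConvexSpace_of_forall_eq
    (h : ∀ y z : X, ‖y‖ = 1 → ‖z‖ = 1 → ‖y + z‖ = 2 → y = z) : StrictConvexSpace ℝ X :=
  StrictConvexSpace.of_norm_add fun y z hy hz hyz => by
    rw [h y z hy hz hyz]

theorem parallelogram_of_orbit_norm_close (hX : IsConvexTransitive X) {x : X}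
    {f : StrongDual ℝ X} (h : IsBicontractivePair x f)
    (hA : ∀ ε > 0, ∃ δ > 0, ∀ T : X ≃ₗᵢ[ℝ] X, 1 - δ < f (T x) → ‖T x - x‖ ≤ ε) (y z : X) :
    ‖y + z‖ * ‖y + z‖ + ‖y - z‖ * ‖y - z‖ = 2 * (‖y‖ * ‖y‖ + ‖z‖ * ‖z‖) := by
  have hexp : ∀ ε > 0, ∃ δ > 0, ∀ w, ‖w‖ ≤ 1 → 1 - δ < f w → ‖w - x‖ ≤ ε := by
    intro ε hε
    obtain ⟨δ, hδ, hT⟩ := hA (ε / 2) (half_pos hε)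
    refine ⟨δ * ε / 4, by positivity, fun w hw hfw => ?_⟩
    -- A closed convex set containing the orbit contains the ball. The slope `2 / δ` makes a drop of
    -- `δ` in `f` pay for the trivial bound `‖T x - x‖ ≤ 2`.
    have hmem : w ∈ {w : X | ‖w - x‖ + 2 / δ * f w ≤ ε / 2 + 2 / δ} := by
      refine (hX x h.norm_eq).mem_of_orbit_subset (isClosed_le (by fun_prop) continuous_const) ?_
        (fun T => ?_) hw
      · have hc1 : ConvexOn ℝ Set.univ fun w : X => ‖w - x‖ := by
          simpa [sub_eq_add_neg, Function.comp_def] using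
            (convexOn_univ_norm (E := X)).translate_left (-x)
        have hc2 : ConvexOn ℝ Set.univ fun w : X => (2 / δ) * f w :=
          (f.toLinearMap.convexOn convex_univ).smul (by positivity)
        simpa using (hc1.add hc2).convex_le (ε / 2 + 2 / δ)
      · have hfT : f (T x) ≤ 1 := by
          simpa [h.norm_eq] using (abs_le.1 (apply_le_norm h.norm_le (T x))).2
        have hd2 : 0 < 2 / δ := by positivity
        show ‖T x - x‖ + 2 / δ * f (T x) ≤ ε / 2 + 2 / δ
        by_cases hc : 1 - δ < f (T x)
        · have := hT T hc
          nlinarith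
        · have h1 := norm_sub_le (T x) x
          rw [T.norm_map, h.norm_eq] at h1
          have h2 : 2 / δ * f (T x) ≤ 2 / δ * (1 - δ) :=
            mul_le_mul_of_nonneg_left (not_lt.1 hc) hd2.le
          have h3 : 2 / δ * (1 - δ) = 2 / δ - 2 := by field_simp
          linarith
    have hmem : ‖w - x‖ + 2 / δ * f w ≤ ε / 2 + 2 / δ := hmem
    have h2 : 2 / δ * (1 - δ * ε / 4) ≤ 2 / δ * f w :=
      mul_le_mul_of_nonneg_left hfw.le (by positivity)
    have h3 : 2 / δ * (1 - δ * ε / 4) = 2 / δ - ε / 2 := by field_simp; ring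
    linarith
  have happ : ∀ y : X, ‖y‖ = 1 → ∀ δ > 0, ∃ T : X ≃ₗᵢ[ℝ] X, 1 - δ < f (T y) := fun y hy δ hδ =>
    (hX y hy).exists_lt_apply f h.norm_eq.le (by rw [h.apply_self]; linarith)
  have hd : ∀ y : X, ‖y‖ = 1 → ∀ ε > 0, ∃ T : X ≃ₗᵢ[ℝ] X, ‖T x - y‖ < ε := by
    intro y hy ε hε
    obtain ⟨δ, hδ, hexp⟩ := hexp (ε / 2) (half_pos hε)
    obtain ⟨T, hT⟩ := happ y hy δ hδ
    refine ⟨T.symm, ?_⟩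
    have := hexp (T y) (by simp [hy]) hT
    rw [← T.norm_map, map_sub, T.apply_symm_apply, norm_sub_rev]
    linarith
  have : StrictConvexSpace ℝ X := by
    refine strictConvexSpace_of_forall_eq fun y z hy hz hyz => ?_
    have hm : ‖(1 / 2 : ℝ) • (y + z)‖ = 1 := by rw [norm_smul, hyz]; norm_num
    refine eq_of_norm_sub_le_zero (le_of_forall_pos_le_add fun ε hε => ?_)
    obtain ⟨δ, hδ, hexp⟩ := hexp (ε / 2) (half_pos hε)
    obtain ⟨T, hT⟩ := happ _ hm (δ / 2) (half_pos hδ)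
    rw [map_smul, map_add, map_smul, map_add, smul_eq_mul] at hT
    have b1 := (abs_le.1 (apply_le_norm h.norm_le (T y))).2
    have b2 := (abs_le.1 (apply_le_norm h.norm_le (T z))).2
    rw [T.norm_map] at b1 b2
    have c1 := hexp (T y) (by simp [hy]) (by linarith)
    have c2 := hexp (T z) (by simp [hz]) (by linarith)
    have c3 := norm_sub_le (T y - x) (T z - x)
    rw [sub_sub_sub_cancel_right, ← map_sub, T.norm_map] at c3
    linarith
  exact parallelogram_of_dense_orbit h hd y z

theorem parallelogram_dual_of_orbit_functional_close (hX : IsConvexTransitive X) {x : X}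
    {f : StrongDual ℝ X} (h : IsBicontractivePair x f)
    (hB : ∀ ε > 0, ∃ δ > 0, ∀ T : X ≃ₗᵢ[ℝ] X, 1 - δ < f (T x) →
      ∀ z, |f (T z) - f z| ≤ ε * ‖z‖) (g k : StrongDual ℝ X) :
    ‖g + k‖ * ‖g + k‖ + ‖g - k‖ * ‖g - k‖ = 2 * (‖g‖ * ‖g‖ + ‖k‖ * ‖k‖) := by
  have hexp : ∀ ε > 0, ∃ δ > 0, ∀ g : StrongDual ℝ X, ‖g‖ ≤ 1 → 1 - δ < g x → ‖g - f‖ ≤ ε := by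
    intro ε hε
    obtain ⟨δ, hδ, hT⟩ := hB (ε / 2) (half_pos hε)
    refine ⟨δ * ε / 4, by positivity, fun g hg hgx => ?_⟩
    have hd2 : 0 < 2 / δ := by positivity
    -- A one-sided smoothness estimate for the norm at `x`, obtained by nearly norming `w + (2 / δ)
    -- • x` by some `f ∘ T`; the slope plays the same role as in the primal case.
    have key : ∀ w : X, ‖w‖ ≤ 1 → ‖w + (2 / δ) • x‖ ≤ f w + ε / 2 + 2 / δ := by
      intro w hw
      by_contra hcon
      push Not at hcon
      set v := w + (2 / δ) • x with hv
      have hfw := abs_le.1 (apply_le_norm h.norm_le w)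
      have hv0 : 0 < ‖v‖ := by
        have h1 := (abs_le.1 (apply_le_norm h.norm_le v)).1
        rw [hv, map_add, map_smul, h.apply_self, smul_eq_mul, mul_one] at h1
        by_contra h0
        have h00 : ‖v‖ = 0 := le_antisymm (not_lt.1 h0) (norm_nonneg _)
        rw [← hv, h00] at h1
        linarith
      have hvu : ‖‖v‖⁻¹ • v‖ = 1 := norm_smul_inv_norm (𝕜 := ℝ) (norm_pos_iff.1 hv0)
      obtain ⟨T, hT'⟩ := (hX _ hvu).exists_lt_apply f h.norm_eq.le
        (a := (f w + ε / 2 + 2 / δ) / ‖v‖) (by rw [h.apply_self, div_lt_one hv0]; exact hcon)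
      rw [map_smul, map_smul, smul_eq_mul, div_eq_inv_mul,
        mul_lt_mul_iff_right₀ (inv_pos.2 hv0), hv, map_add, map_smul, map_add, map_smul,
        smul_eq_mul] at hT'
      have b1 : f (T x) ≤ 1 := by
        simpa [h.norm_eq] using (abs_le.1 (apply_le_norm h.norm_le (T x))).2
      have b2 := (abs_le.1 (apply_le_norm h.norm_le (T w))).2
      rw [T.norm_map] at b2
      by_cases hc : 1 - δ < f (T x)
      · have b3 := (abs_le.1 (hT T hc w)).2
        have b4 : ε / 2 * ‖w‖ ≤ ε / 2 * 1 := mul_le_mul_of_nonneg_left hw (by positivity)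
        nlinarith
      · have b5 : 2 / δ * f (T x) ≤ 2 / δ * (1 - δ) :=
          mul_le_mul_of_nonneg_left (not_lt.1 hc) hd2.le
        have b6 : 2 / δ * (1 - δ) = 2 / δ - 2 := by field_simp
        linarith
    have h3 : 2 / δ * (1 - δ * ε / 4) = 2 / δ - ε / 2 := by field_simp; ring
    have h2 : 2 / δ * (1 - δ * ε / 4) ≤ 2 / δ * g x :=
      mul_le_mul_of_nonneg_left hgx.le hd2.le
    have one : ∀ w : X, ‖w‖ ≤ 1 → g w - f w ≤ ε := fun w hw => by
      have h1 := (abs_le.1 (apply_le_norm hg (w + (2 / δ) • x))).2.trans (key w hw)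
      rw [map_add, map_smul, smul_eq_mul] at h1
      linarith
    refine ContinuousLinearMap.opNorm_le_of_unit_norm (𝕜 := ℝ) hε.le fun w hw => ?_
    rw [Real.norm_eq_abs, sub_apply]
    refine abs_le.2 ⟨?_, one w hw.le⟩
    have := one (-w) (by simpa using hw.le)
    rw [map_neg, map_neg] at this
    linarith
  have hpair : IsBicontractivePair f (NormedSpace.inclusionInDoubleDual ℝ X x) := by
    refine ⟨le_antisymm h.norm_le ?_, h.apply_self, ?_, fun g => ?_⟩
    · have := f.le_opNorm x
      rwa [h.apply_self, h.norm_eq, norm_one, mul_one] at this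
    · exact (NormedSpace.double_dual_bound ℝ X x).trans_eq h.norm_eq
    · refine ContinuousLinearMap.opNorm_le_bound _ (norm_nonneg _) fun z => ?_
      have h1 : (g - (NormedSpace.inclusionInDoubleDual ℝ X x) g • f) z = g (z - f z • x) := by
        simp [mul_comm]
      rw [h1]
      exact g.le_opNorm_of_le (h.contractive z)
  have happ : ∀ g : StrongDual ℝ X, ‖g‖ = 1 → ∀ δ > 0,
      ∃ T : X ≃ₗᵢ[ℝ] X, 1 - δ < g (T x) := fun g hg δ hδ =>
    exists_lt_apply_of_lt_norm hX h.norm_eq (by rw [hg]; linarith)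
  have hd : ∀ g : StrongDual ℝ X, ‖g‖ = 1 → ∀ ε > 0,
      ∃ T : StrongDual ℝ X ≃ₗᵢ[ℝ] StrongDual ℝ X, ‖T f - g‖ < ε := by
    intro g hg ε hε
    obtain ⟨δ, hδ, hexp⟩ := hexp (ε / 2) (half_pos hε)
    obtain ⟨T, hT⟩ := happ g hg δ hδ
    refine ⟨(dualIsometry T).symm, ?_⟩
    have := hexp (dualIsometry T g) (by simp [hg]) (by rw [dualIsometry_apply]; linarith)
    rw [← (dualIsometry T).norm_map, map_sub, LinearIsometryEquiv.apply_symm_apply, norm_sub_rev]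
    linarith
  have : StrictConvexSpace ℝ (StrongDual ℝ X) := by
    refine strictConvexSpace_of_forall_eq fun g k hg hk hgk => ?_
    have hm : ‖(1 / 2 : ℝ) • (g + k)‖ = 1 := by rw [norm_smul, hgk]; norm_num
    refine eq_of_norm_sub_le_zero (le_of_forall_pos_le_add fun ε hε => ?_)
    obtain ⟨δ, hδ, hexp⟩ := hexp (ε / 2) (half_pos hε)
    obtain ⟨T, hT⟩ := happ _ hm (δ / 2) (half_pos hδ)
    rw [smul_apply, add_apply, smul_eq_mul] at hT
    have b1 := (abs_le.1 (apply_le_norm hg.le (T x))).2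
    have b2 := (abs_le.1 (apply_le_norm hk.le (T x))).2
    rw [T.norm_map, h.norm_eq] at b1 b2
    have c1 := hexp (dualIsometry T g) (by simp [hg]) (by rw [dualIsometry_apply]; linarith)
    have c2 := hexp (dualIsometry T k) (by simp [hk]) (by rw [dualIsometry_apply]; linarith)
    have c3 := norm_sub_le (dualIsometry T g - f) (dualIsometry T k - f)
    rw [sub_sub_sub_cancel_right, ← map_sub, LinearIsometryEquiv.norm_map] at c3
    linarith
  exact parallelogram_of_dense_orbit hpair hd g k

/-- Norming functionals of `x + y` and `x - y`, weighted by those norms, satisfy the dual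
parallelogram law; pairing their sum with `x` and their difference with `y` gives the bound. -/
theorem parallelogram_le_of_dual
    (hD : ∀ g k : StrongDual ℝ X,
      ‖g + k‖ * ‖g + k‖ + ‖g - k‖ * ‖g - k‖ = 2 * (‖g‖ * ‖g‖ + ‖k‖ * ‖k‖)) (x y : X) :
    ‖x + y‖ * ‖x + y‖ + ‖x - y‖ * ‖x - y‖ ≤ 2 * (‖x‖ * ‖x‖ + ‖y‖ * ‖y‖) := by
  obtain ⟨g, hg, hgx⟩ := exists_dual_vector'' ℝ (x + y)
  obtain ⟨k, hk, hkx⟩ := exists_dual_vector'' ℝ (x - y)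
  set a := ‖x + y‖
  set b := ‖x - y‖
  have hgx : g (x + y) = a := hgx
  have hkx : k (x - y) = b := hkx
  have ha : 0 ≤ a := norm_nonneg _
  have hb : 0 ≤ b := norm_nonneg _
  have h1 : a * a + b * b = (a • g + b • k) x + (a • g - b • k) y := by
    rw [map_add] at hgx
    rw [map_sub] at hkx
    simp only [add_apply, sub_apply,
      smul_apply, smul_eq_mul]
    linear_combination -a * hgx - b * hkx
  have h2 := (le_abs_self _).trans ((a • g + b • k).le_opNorm x)
  have h3 := (le_abs_self _).trans ((a • g - b • k).le_opNorm y)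
  have h4 := hD (a • g) (b • k)
  set A := ‖a • g + b • k‖
  set B := ‖a • g - b • k‖
  have h5 : ‖a • g‖ ≤ a := by
    rw [norm_smul, Real.norm_of_nonneg ha]; exact mul_le_of_le_one_right ha hg
  have h6 : ‖b • k‖ ≤ b := by
    rw [norm_smul, Real.norm_of_nonneg hb]; exact mul_le_of_le_one_right hb hk
  have h7 : A * A + B * B ≤ 2 * (a * a + b * b) := by
    rw [h4]
    have := mul_self_le_mul_self (norm_nonneg _) h5
    have := mul_self_le_mul_self (norm_nonneg _) h6
    linarith
  nlinarith [mul_self_nonneg (A - 2 * ‖x‖), mul_self_nonneg (B - 2 * ‖y‖)]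

theorem parallelogram_of_dual
    (hD : ∀ g k : StrongDual ℝ X,
      ‖g + k‖ * ‖g + k‖ + ‖g - k‖ * ‖g - k‖ = 2 * (‖g‖ * ‖g‖ + ‖k‖ * ‖k‖)) (x y : X) :
    ‖x + y‖ * ‖x + y‖ + ‖x - y‖ * ‖x - y‖ = 2 * (‖x‖ * ‖x‖ + ‖y‖ * ‖y‖) := by
  refine le_antisymm (parallelogram_le_of_dual hD x y) ?_
  -- The inequality applied to sum and difference is its own converse.
  have h := parallelogram_le_of_dual hD (x + y) (x - y)
  have h1 : x + y + (x - y) = (2 : ℝ) • x := by module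
  have h2 : x + y - (x - y) = (2 : ℝ) • y := by module
  rw [h1, h2, norm_smul, norm_smul] at h
  norm_num at h
  linarith

end Transfer

end RotationProblem

theorem theorem5p3 {X : Type*} [NormedAddCommGroup X] [NormedSpace ℝ X] [CompleteSpace X]
    (hX : RotationProblem.IsConvexTransitive X)
    (hP : ∃ (L : Submodule ℝ X) (P : X →L[ℝ] X),
      Module.finrank ℝ L = 1 ∧ RotationProblem.IsBicontractiveProjection P L)
    (hx : ∃ x : X, RotationProblem.IsWeakLURPoint x) :
    RotationProblem.IsIsometricallyHilbert X := by
  open RotationProblem in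
  obtain ⟨x, hx⟩ := hx
  obtain ⟨e, φ, hφ⟩ := exists_bicontractivePair_of_isBicontractiveProjection hP
  obtain ⟨f, hf⟩ := exists_bicontractivePair_of_isWeakLURPoint hX hx hφ
  have hpar : ∀ y z : X,
      ‖y + z‖ * ‖y + z‖ + ‖y - z‖ * ‖y - z‖ = 2 * (‖y‖ * ‖y‖ + ‖z‖ * ‖z‖) := by
    rcases orbit_dichotomy hf (hx.apply_gt hf.apply_self) with hA | hB
    · exact parallelogram_of_orbit_norm_close hX hf hA
    · exact parallelogram_of_dual (parallelogram_dual_of_orbit_functional_close hX hf hB)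
  exact ⟨X, inferInstance, InnerProductSpace.ofNorm ℝ hpar, inferInstance,
    ⟨LinearIsometryEquiv.refl ℝ X⟩⟩
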